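/- A finite word over a finite alphabet $\Sigma$ is an element of $\Sigma^\star$. The convolution of words $x_1,\dots,x_k\in\Sigma^\star$ is the word over $(\Sigma\cup\{\Diamond\})^k$ obtained by padding each $x_j$ at its end with the new symbol $\Diamond$ up to the maximal length of the $x_j$ and reading the padded words in parallel. A relation $R\subseteq(\Sigma^\star)^k$ is regular if the set of convolutions of its tuples is recognized by a finite automaton. A structure is called word automatic if it is isomorphic to a structure whose domain is a regular set of words over some finite alphabet and all of whose basic relations and graphs of basic operations (including constants) are regular. A Boolean algebra is regarded as a structure $(D;\vee,\wedge,\neg,0,1)$. Let $\mathcal B_\omega$ be the Boolean algebra of all finite and cofinite subsets of $\omega$, with the set operations, and let $\mathcal B_\omega^n$ be its $n$-fold Cartesian power. Theorem (Khoussainov, Nies, Rubin, Stephan; 2004). A Boolean algebra is word automatic if and only if it is finite or isomorphic to $\mathcal B_\omega^n$ for some $n\geq 1$. (In particular, an infinite Boolean algebra is word automatic if and only if it is isomorphic to $\mathcal B_\omega^n$ for some $n\ge 1$.) -/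

import Mathlib

/-! ### Regular relations on finite words -/

/-- The convolution of the words `x 0, …, x (k - 1)` over the alphabet `A`: a word whose length is
the maximal length of the `x j`, and whose `i`-th letter is the tuple of the `i`-th letters of the
`x j`, where `none` is the padding symbol `◇` used beyond the end of a word. -/
def convolution {A : Type*} {k : ℕ} (x : Fin k → List A) : List (Fin k → Option A) :=
  List.ofFn (n := Finset.univ.sup fun j => (x j).length) fun i j => (x j)[(i : ℕ)]?

/-- The convolution of a `k`-ary relation on words, as a language over `(A ∪ {◇})^k`. -/
def convolutionLanguage {A : Type*} {k : ℕ} (R : Set (Fin k → List A)) :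
    _root_.Language (Fin k → Option A) :=
  convolution '' R

/-- A relation on words is regular if its convolution is a regular language. -/
def IsRegularRelation {A : Type*} {k : ℕ} (R : Set (Fin k → List A)) : Prop :=
  (convolutionLanguage R).IsRegular

/-! ### Word automatic structures -/

/-- The graph of an operation on a set `D` of words, as a relation on words. -/
def wordGraph {A : Type*} {D : Set (List A)} {k : ℕ} (f : (Fin k → D) → D) :
    Set (Fin (k + 1) → List A) :=
  {x | ∃ a : Fin k → D, x = Fin.snoc (fun i => (a i : List A)) (f a : List A)}

/-- A relation on a set `D` of words, as a relation on words. -/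
def wordRelation {A : Type*} {D : Set (List A)} {k : ℕ} (r : (Fin k → D) → Prop) :
    Set (Fin k → List A) :=
  {x | ∃ a : Fin k → D, r a ∧ x = fun i => (a i : List A)}

/-- A structure whose domain is a set `D` of words over `A` is word automatic if its domain and its
basic operations (through their graphs) and relations are regular. -/
structure IsWordAutomatic (L : FirstOrder.Language) {A : Type} (D : Set (List A))
    [L.Structure D] : Prop where
  domain : _root_.Language.IsRegular (T := A) D
  operations : ∀ (k : ℕ) (f : L.Functions k),
    IsRegularRelation (wordGraph fun a : Fin k → D => FirstOrder.Language.Structure.funMap f a)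
  relations : ∀ (k : ℕ) (r : L.Relations k),
    IsRegularRelation (wordRelation fun a : Fin k → D => FirstOrder.Language.Structure.RelMap r a)

/-- A structure is word automata presentable if it is isomorphic to a word automatic structure over
some finite alphabet. -/
def IsWordAutomataPresentable (L : FirstOrder.Language) (M : Type*) [L.Structure M] : Prop :=
  ∃ (A : Type) (_ : Finite A) (D : Set (List A)) (_ : L.Structure D),
    IsWordAutomatic L D ∧ Nonempty (L.Equiv M D)

/-! ### Boolean algebras as structures `(D; ∨, ∧, ¬, 0, 1)` -/

/-- The operation symbols of Boolean algebras, indexed by their arities. -/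
inductive BooleanFunctions : ℕ → Type
  | bot : BooleanFunctions 0
  | top : BooleanFunctions 0
  | compl : BooleanFunctions 1
  | sup : BooleanFunctions 2
  | inf : BooleanFunctions 2

/-- The first-order language of Boolean algebras. -/
def booleanLanguage : FirstOrder.Language where
  Functions := BooleanFunctions
  Relations := fun _ => Empty

/-- A Boolean algebra as a first-order structure. -/
instance booleanStructure (B : Type*) [BooleanAlgebra B] : booleanLanguage.Structure B where
  funMap := fun {_} f => match f with
    | BooleanFunctions.bot => fun _ => ⊥
    | BooleanFunctions.top => fun _ => ⊤
    | BooleanFunctions.compl => fun a => (a 0)ᶜ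
    | BooleanFunctions.sup => fun a => a 0 ⊔ a 1
    | BooleanFunctions.inf => fun a => a 0 ⊓ a 1
  RelMap := fun {_} r => r.elim

/-- `B_ω`: the Boolean algebra of all finite and cofinite subsets of `ℕ`. -/
def finiteCofinite : BooleanSubalgebra (Set ℕ) where
  carrier := {s | s.Finite ∨ sᶜ.Finite}
  bot_mem' := Or.inl Set.finite_empty
  compl_mem' := by
    intro s hs
    simpa [or_comm] using hs
  supClosed' := by
    rintro s (hs | hs) t (ht | ht)
    · exact Or.inl (hs.union ht)
    · exact Or.inr (ht.subset (Set.compl_subset_compl.2 Set.subset_union_right))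
    · exact Or.inr (hs.subset (Set.compl_subset_compl.2 Set.subset_union_left))
    · exact Or.inr (hs.subset (Set.compl_subset_compl.2 Set.subset_union_left))
  infClosed' := by
    rintro s (hs | hs) t (ht | ht)
    · exact Or.inl (hs.subset Set.inter_subset_left)
    · exact Or.inl (hs.subset Set.inter_subset_left)
    · exact Or.inl (ht.subset Set.inter_subset_right)
    · right
      change (s ∩ t)ᶜ.Finite
      rw [Set.compl_inter]
      exact hs.union ht

/-!
Suppose that an infinite Boolean algebra `B` is word automatic. Pumping in an automaton for the
graph of an operation shows that the operation increases word lengths by at most a constant, and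
that below an element with infinitely many elements beneath it there are elements that are only
slightly longer. So an element with infinitely many elements beneath it can be cut into `n` parts of
length `O(n)`. The joins of subfamilies of such parts are exponentially many, and arranging each
join as a balanced binary tree keeps it short. As there are only exponentially many words of a given
length, the number of disjoint elements with infinitely many elements beneath them is bounded. Hence
`⊤` is a finite disjoint join of elements that cannot be split into two such elements, and below
each of these, mapping an element to the set of atoms under it gives an isomorphism with `B_ω`.

Conversely, an element of `B_ω ^ n` is an eventually constant sequence of subsets of `Fin n`. Such a
sequence over a finite alphabet is encoded by the shortest word from which it arises by repeating
the last letter forever, and pointwise operations on sequences can be checked letter by letter.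
-/

/-! ### Convolutions -/

section Convolution

variable {A : Type*} {k : ℕ}

theorem getElem?_convolution (x : Fin k → List A) (t : ℕ) [Decidable (∃ j, t < (x j).length)] :
    (convolution x)[t]? = if ∃ j, t < (x j).length then some fun j => (x j)[t]? else none := by
  simp only [convolution, List.getElem?_ofFn, Finset.lt_sup_iff, Finset.mem_univ, true_and,
    dite_eq_ite]

@[simp]
theorem convolution_nil : convolution (fun _ : Fin k => ([] : List A)) = [] := by
  classical
  exact List.ext_getElem? fun t => by simp [getElem?_convolution]

theorem convolution_eq_cons {x : Fin k → List A} (h : ∃ j, x j ≠ []) :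
    convolution x = (fun j => (x j).head?) :: convolution fun j => (x j).tail := by
  classical
  refine List.ext_getElem? fun t => ?_
  cases t with
  | zero =>
    have h0 : ∃ j, 0 < (x j).length := h.imp fun j => List.length_pos_of_ne_nil
    simp [getElem?_convolution, h0, List.head?_eq_getElem?]
  | succ t => simp [getElem?_convolution, Nat.lt_sub_iff_add_lt]

theorem convolution_eq_nil_iff {x : Fin k → List A} : convolution x = [] ↔ x = fun _ => [] := by
  refine ⟨fun h => ?_, fun h => h ▸ convolution_nil⟩
  contrapose! h
  rw [convolution_eq_cons (Function.ne_iff.1 h)]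
  exact List.cons_ne_nil _ _

theorem convolution_eq_cons_iff {x : Fin k → List A} {u : Fin k → Option A}
    {w : List (Fin k → Option A)} :
    convolution x = u :: w ↔ (∃ j, x j ≠ []) ∧ (fun j => (x j).head?) = u ∧
      convolution (fun j => (x j).tail) = w := by
  constructor
  · intro h
    have hx : ∃ j, x j ≠ [] := by
      by_contra! hx
      simp [funext hx] at h
    rw [convolution_eq_cons hx, List.cons.injEq] at h
    exact ⟨hx, h⟩
  · rintro ⟨hx, rfl, rfl⟩
    exact convolution_eq_cons hx

theorem filterMap_convolution (x : Fin k → List A) (j : Fin k) :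
    (convolution x).filterMap (fun u => u j) = x j := by
  generalize hw : convolution x = w
  induction w generalizing x with
  | nil => simp [convolution_eq_nil_iff.1 hw]
  | cons u w ih =>
    obtain ⟨-, rfl, hw'⟩ := convolution_eq_cons_iff.1 hw
    cases hx : x j <;> simp [hx, ih _ hw']

theorem convolution_injective :
    Function.Injective (convolution : (Fin k → List A) → List (Fin k → Option A)) :=
  fun x y h => funext fun j => by rw [← filterMap_convolution x, h, filterMap_convolution]

theorem convolution_mem_convolutionLanguage {R : Set (Fin k → List A)} {x : Fin k → List A} :
    convolution x ∈ convolutionLanguage R ↔ x ∈ R :=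
  convolution_injective.mem_set_image

theorem convolution_update_cons (x : Fin k → List A) (l : Fin k) (a : A) (p : List A) :
    convolution (Function.update x l (a :: p)) =
      Function.update (fun j => (x j).head?) l (some a) ::
        convolution (Function.update (fun j => (x j).tail) l p) := by
  rw [convolution_eq_cons ⟨l, by simp⟩]
  congr 2 <;> ext1 j <;> rcases eq_or_ne j l with rfl | hj <;> simp [*]

theorem convolution_update_nil (l : Fin k) (t : List A) :
    convolution (Function.update (fun _ => []) l t) =
      t.map fun a => Function.update (fun _ => none) l (some a) := by
  induction t with
  | nil => simp
  | cons a t ih => simp [convolution_update_cons, ih]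

theorem convolution_update_append (x : Fin k → List A) (l : Fin k) (p t : List A)
    (h : ∀ i ≠ l, (x i).length ≤ p.length) :
    convolution (Function.update x l (p ++ t)) = convolution (Function.update x l p) ++
      t.map fun a => Function.update (fun _ => none) l (some a) := by
  induction p generalizing x with
  | nil =>
    have hx (s : List A) : Function.update x l s = Function.update (fun _ => []) l s := by
      ext1 i
      rcases eq_or_ne i l with rfl | hi
      · simp
      · simpa [hi] using h i hi
    simp [hx, convolution_update_nil]
  | cons a p ih =>
    simp only [List.cons_append, convolution_update_cons]
    rw [ih _ fun i hi => by simpa using h i hi]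

end Convolution

/-! ### Word lengths under regular operations -/

theorem exists_length_le_of_append_map_mem {α β : Type*} {L : _root_.Language α} (hL : L.IsRegular)
    (f : β → α) :
    ∃ c, ∀ (p : List α) (t : List β), p ++ t.map f ∈ L →
      ∃ t' : List β, t'.length ≤ c ∧ p ++ t'.map f ∈ L := by
  have hQ (Q : _root_.Language α) :
      ∃ n, ∀ t : List β, t.map f ∈ Q → ∃ t' : List β, t'.length ≤ n ∧ t'.map f ∈ Q := by
    by_cases h : ∃ t : List β, t.map f ∈ Q
    · obtain ⟨t, ht⟩ := h
      exact ⟨t.length, fun _ _ => ⟨t, le_rfl, ht⟩⟩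
    · exact ⟨0, fun t ht => (h ⟨t, ht⟩).elim⟩
  choose n hn using hQ
  obtain ⟨c, hc⟩ := (hL.finite_range_leftQuotient.image n).bddAbove
  refine ⟨c, fun p t ht => ?_⟩
  obtain ⟨t', ht', hmem⟩ := hn (L.leftQuotient p) t ht
  exact ⟨t', ht'.trans (hc ⟨_, ⟨p, rfl⟩, rfl⟩), hmem⟩

theorem IsRegularRelation.exists_update_mem {A : Type*} {k : ℕ} {R : Set (Fin k → List A)}
    (hR : IsRegularRelation R) (l : Fin k) :
    ∃ c, ∀ x ∈ R, ∀ m ≤ (x l).length, (∀ i ≠ l, (x i).length ≤ m) →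
      ∃ y : List A, Function.update x l y ∈ R ∧ m ≤ y.length ∧ y.length ≤ m + c := by
  obtain ⟨c, hc⟩ := exists_length_le_of_append_map_mem hR
    fun a => Function.update (fun _ => none) l (some a)
  refine ⟨c, fun x hx m hm hle => ?_⟩
  have hlen : ((x l).take m).length = m := List.length_take_of_le hm
  have happend (t : List A) := convolution_update_append x l ((x l).take m) t (by simpa [hlen])
  obtain ⟨t, ht, hmem⟩ := hc (convolution (Function.update x l ((x l).take m))) ((x l).drop m) <| by
    rwa [← happend, List.take_append_drop, Function.update_eq_self,
      convolution_mem_convolutionLanguage]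
  refine ⟨(x l).take m ++ t, ?_, by simp [hm], by simp [hm, ht]⟩
  rwa [← happend, convolution_mem_convolutionLanguage] at hmem

section RegularOperation

variable {A : Type*} {D : Set (List A)} {k : ℕ} {f : (Fin k → D) → D}

theorem IsRegularRelation.exists_length_apply_le (hf : IsRegularRelation (wordGraph f)) :
    ∃ c, ∀ (a : Fin k → D) (m : ℕ), (∀ i, (a i).1.length ≤ m) → (f a).1.length ≤ m + c := by
  obtain ⟨c, hc⟩ := hf.exists_update_mem (Fin.last k)
  refine ⟨c, fun a m ha => ?_⟩
  by_contra! hlt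
  obtain ⟨y, ⟨b, hb⟩, -, hy⟩ := hc _ ⟨a, rfl⟩ m (by simp; lia) fun i hi => by
    obtain ⟨j, rfl⟩ := Fin.exists_castSucc_eq.2 hi
    simpa using ha j
  rw [Fin.update_snoc_last, Fin.snoc_inj] at hb
  obtain ⟨hab, rfl⟩ := hb
  obtain rfl : a = b := funext fun i => Subtype.ext (congrFun hab i)
  lia

theorem IsRegularRelation.exists_apply_update_eq (hf : IsRegularRelation (wordGraph f))
    (i : Fin k) :
    ∃ c, ∀ (a : Fin k → D) (m : ℕ), m ≤ (a i).1.length → (∀ j ≠ i, (a j).1.length ≤ m) →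
      (f a).1.length ≤ m →
        ∃ b : D, f (Function.update a i b) = f a ∧ m ≤ b.1.length ∧ b.1.length ≤ m + c := by
  obtain ⟨c, hc⟩ := hf.exists_update_mem i.castSucc
  refine ⟨c, fun a m ha hle hfa => ?_⟩
  obtain ⟨y, ⟨b, hb⟩, hy⟩ := hc _ ⟨a, rfl⟩ m (by simpa) fun j hj => by
    cases j using Fin.lastCases with
    | last => simpa using hfa
    | cast j => simpa using hle j (by simpa using hj)
  rw [← Fin.snoc_update, Fin.snoc_inj] at hb
  obtain ⟨hab, hfab⟩ := hb
  have hb : b = Function.update a i (b i) := by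
    refine Function.eq_update_iff.2 ⟨rfl, fun j hj => Subtype.ext ?_⟩
    simpa [hj] using (congrFun hab j).symm
  refine ⟨b i, by rw [← hb]; exact Subtype.ext hfab.symm, ?_⟩
  simpa [← congrFun hab i] using hy

end RegularOperation

theorem encard_length_le_le {A : Type*} [Finite A] (n : ℕ) :
    {w : List A | w.length ≤ n}.encard ≤ ((Nat.card A + 1) ^ n : ℕ) := by
  let letters (w : {w : List A | w.length ≤ n}) : Fin n → Option A := fun i => w.1[i.1]?
  have hinj : Function.Injective letters := by
    rintro ⟨v, hv⟩ ⟨w, hw⟩ h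
    refine Subtype.ext (List.ext_getElem? fun i => ?_)
    rcases lt_or_ge i n with hi | hi
    · exact congrFun h ⟨i, hi⟩
    · rw [List.getElem?_eq_none (hv.trans hi), List.getElem?_eq_none (hw.trans hi)]
  have hcard := ENat.card_le_card_of_injective hinj
  rwa [ENat.card_eq_coe_natCard (Fin n → Option A), Nat.card_fun, Nat.card_fin,
    Finite.card_option] at hcard

/-! ### Length functions on Boolean algebras -/

/-- A length function on a Boolean algebra with the properties of the word lengths in a word
automatic copy of it: there are at most exponentially many elements of a given length, joins have
controlled lengths, and an element `x` with infinitely many elements below it is split by an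
element that is not much longer than `x`, and whose complement in `x` is not much longer either. -/
structure IsTameLength {B : Type*} [BooleanAlgebra B] (ℓ : B → ℕ) (K c : ℕ) : Prop where
  encard_le (n : ℕ) : {b | ℓ b ≤ n}.encard ≤ (K ^ n : ℕ)
  bot_le : ℓ ⊥ ≤ c
  sup_le (a b : B) : ℓ (a ⊔ b) ≤ max (ℓ a) (ℓ b) + c
  exists_split (x : B) (hx : (Set.Iic x).Infinite) :
    ∃ a ≤ x, a ≠ ⊥ ∧ a ≠ x ∧ ℓ a ≤ ℓ x + c ∧ ℓ (x \ a) ≤ ℓ x + c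

open FirstOrder.Language.Structure in
theorem IsWordAutomatic.exists_length_funMap_le {L : FirstOrder.Language} {A : Type}
    {D : Set (List A)} [L.Structure D] (h : IsWordAutomatic L D) {M : Type*} [L.Structure M]
    (e : L.Equiv M D) {k : ℕ} (f : L.Functions k) :
    ∃ c, ∀ (x : Fin k → M) (m : ℕ), (∀ i, (e (x i)).1.length ≤ m) →
      (e (funMap f x)).1.length ≤ m + c := by
  obtain ⟨c, hc⟩ := (h.operations k f).exists_length_apply_le
  exact ⟨c, fun x m hx => by simpa only [e.map_fun] using hc (e ∘ x) m hx⟩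

open FirstOrder.Language.Structure in
theorem IsWordAutomatic.exists_funMap_update_eq {L : FirstOrder.Language} {A : Type}
    {D : Set (List A)} [L.Structure D] (h : IsWordAutomatic L D) {M : Type*} [L.Structure M]
    (e : L.Equiv M D) {k : ℕ} (f : L.Functions k) (i : Fin k) :
    ∃ c, ∀ (x : Fin k → M) (m : ℕ), m ≤ (e (x i)).1.length →
      (∀ j ≠ i, (e (x j)).1.length ≤ m) → (e (funMap f x)).1.length ≤ m →
        ∃ y : M, funMap f (Function.update x i y) = funMap f x ∧
          m ≤ (e y).1.length ∧ (e y).1.length ≤ m + c := by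
  obtain ⟨c, hc⟩ := (h.operations k f).exists_apply_update_eq i
  refine ⟨c, fun x m hm hle hfx => ?_⟩
  obtain ⟨b, hb, hlen⟩ := hc (e ∘ x) m hm hle (by rwa [← e.map_fun])
  obtain ⟨y, rfl⟩ := e.surjective b
  rw [← Function.comp_update, ← e.map_fun, ← e.map_fun] at hb
  exact ⟨y, e.injective hb, hlen⟩

theorem IsWordAutomatic.exists_le_length_le {A : Type} {D : Set (List A)}
    [booleanLanguage.Structure D] (h : IsWordAutomatic booleanLanguage D) {B : Type*}
    [BooleanAlgebra B] (e : booleanLanguage.Equiv B D) :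
    ∃ c, ∀ x a : B, a ≤ x → ∀ m, (e x).1.length ≤ m → m ≤ (e a).1.length →
      ∃ b ≤ x, m ≤ (e b).1.length ∧ (e b).1.length ≤ m + c := by
  obtain ⟨c, hc⟩ := h.exists_funMap_update_eq e BooleanFunctions.sup 0
  refine ⟨c, fun x a hax m hxm hma => ?_⟩
  have hsup : a ⊔ x = x := sup_eq_right.2 hax
  obtain ⟨b, hb, hlen⟩ := hc ![a, x] m hma (by simpa [Fin.forall_fin_two] using hxm) <| by
    change (e (a ⊔ x)).1.length ≤ m
    rwa [hsup]
  have hbx : b ⊔ x = a ⊔ x := hb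
  exact ⟨b, sup_eq_right.1 (hbx.trans hsup), hlen⟩

theorem IsWordAutomataPresentable.exists_isTameLength {B : Type*} [BooleanAlgebra B]
    (h : IsWordAutomataPresentable booleanLanguage B) :
    ∃ (ℓ : B → ℕ) (K c : ℕ), IsTameLength ℓ K c := by
  obtain ⟨A, _, D, _, hD, ⟨e⟩⟩ := h
  let ℓ (b : B) : ℕ := (e b).1.length
  have encard_le (n : ℕ) : {b | ℓ b ≤ n}.encard ≤ ((Nat.card A + 1) ^ n : ℕ) := by
    have hinj : Function.Injective fun b => (e b).1 := Subtype.val_injective.comp e.injective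
    rw [← hinj.encard_image]
    exact (Set.encard_le_encard (Set.image_preimage_subset _ _)).trans (encard_length_le_le n)
  obtain ⟨cCompl, compl_le⟩ : ∃ c, ∀ a, ℓ aᶜ ≤ ℓ a + c := by
    obtain ⟨c, hc⟩ := hD.exists_length_funMap_le e BooleanFunctions.compl
    exact ⟨c, fun a => hc ![a] (ℓ a) (by simp [ℓ])⟩
  obtain ⟨cInf, inf_le⟩ : ∃ c, ∀ a b, ℓ (a ⊓ b) ≤ max (ℓ a) (ℓ b) + c := by
    obtain ⟨c, hc⟩ := hD.exists_length_funMap_le e BooleanFunctions.inf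
    exact ⟨c, fun a b => hc ![a, b] (max (ℓ a) (ℓ b)) (by simp [ℓ, Fin.forall_fin_two])⟩
  obtain ⟨cSup, sup_le⟩ : ∃ c, ∀ a b, ℓ (a ⊔ b) ≤ max (ℓ a) (ℓ b) + c := by
    obtain ⟨c, hc⟩ := hD.exists_length_funMap_le e BooleanFunctions.sup
    exact ⟨c, fun a b => hc ![a, b] (max (ℓ a) (ℓ b)) (by simp [ℓ, Fin.forall_fin_two])⟩
  obtain ⟨cPump, exists_le⟩ := hD.exists_le_length_le e
  refine ⟨ℓ, _, ℓ ⊥ + 1 + cPump + cCompl + cInf + cSup, encard_le, by lia,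
    fun a b => (sup_le a b).trans (by lia), fun x hx => ?_⟩
  obtain ⟨a, hax, ha⟩ : ∃ a ≤ x, ℓ x + ℓ ⊥ + 1 ≤ ℓ a := by
    by_contra! hlt
    exact hx (Set.Finite.subset (Set.finite_of_encard_le_coe (encard_le (ℓ x + ℓ ⊥)))
      fun a ha => Nat.lt_succ_iff.1 (hlt a ha))
  obtain ⟨b, hbx, hmb, hbm⟩ := exists_le x a hax (ℓ x + ℓ ⊥ + 1) (by lia) ha
  have hdiff : ℓ (x \ b) ≤ max (ℓ x) (ℓ b + cCompl) + cInf := by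
    rw [sdiff_eq]
    exact (inf_le x bᶜ).trans (by grw [compl_le b])
  refine ⟨b, hbx, ?_, ?_, by lia, by lia⟩ <;> rintro rfl <;> lia

theorem exists_add_mul_lt_two_pow (α β : ℕ) : ∃ r : ℕ, α + β * r < 2 ^ r := by
  refine ⟨2 * (α + 2 * β), ?_⟩
  have hlt : α + 2 * β < 2 ^ (α + 2 * β) := Nat.lt_two_pow_self
  rw [pow_mul', sq]
  nlinarith

theorem finite_Iic_sup {α : Type*} [DistribLattice α] {a b : α} (ha : (Set.Iic a).Finite)
    (hb : (Set.Iic b).Finite) : (Set.Iic (a ⊔ b)).Finite := by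
  refine (ha.image2 (· ⊔ ·) hb).subset fun z hz => ?_
  exact ⟨z ⊓ a, inf_le_right, z ⊓ b, inf_le_right,
    (inf_sup_left z a b).symm.trans (inf_eq_left.2 hz)⟩

theorem injOn_sup_powerset_parts {α : Type*} [DistribLattice α] [OrderBot α] {a : α}
    (P : Finpartition a) : Set.InjOn (fun s => s.sup id) (P.parts.powerset : Set (Finset α)) := by
  have subset_of_sup_le {s t : Finset α} (hs : s ⊆ P.parts) (ht : t ⊆ P.parts)
      (h : s.sup id ≤ t.sup id) : s ⊆ t := by
    intro b hb
    by_contra hbt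
    exact P.ne_bot (hs hb)
      ((P.supIndep ht (hs hb) hbt).eq_bot_of_le ((Finset.le_sup (f := id) hb).trans h))
  intro s hs t ht h
  rw [Finset.mem_coe, Finset.mem_powerset] at hs ht
  exact (subset_of_sup_le hs ht h.le).antisymm (subset_of_sup_le ht hs h.ge)

namespace IsTameLength

variable {B : Type*} [BooleanAlgebra B] {ℓ : B → ℕ} {K c : ℕ}

theorem exists_split_infinite_Iic (h : IsTameLength ℓ K c) {x : B} (hx : (Set.Iic x).Infinite) :
    ∃ a ≤ x, (Set.Iic a).Infinite ∧ x \ a ≠ ⊥ ∧ ℓ a ≤ ℓ x + c ∧ ℓ (x \ a) ≤ ℓ x + c := by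
  obtain ⟨a, hax, hbot, hne, hla, hlb⟩ := h.exists_split x hx
  by_cases ha : (Set.Iic a).Finite
  · refine ⟨x \ a, sdiff_le, fun hb => hx ?_, by rwa [sdiff_sdiff_eq_self hax], hlb,
      by rwa [sdiff_sdiff_eq_self hax]⟩
    simpa [sup_sdiff_cancel_right hax] using finite_Iic_sup ha hb
  · exact ⟨a, hax, ha, fun h => hne (hax.antisymm (sdiff_eq_bot_iff.1 h)), hla, hlb⟩

theorem exists_finpartition (h : IsTameLength ℓ K c) (n : ℕ) {x : B} (hx : (Set.Iic x).Infinite) :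
    ∃ P : Finpartition x, P.parts.card = n + 1 ∧ ∀ b ∈ P.parts, ℓ b ≤ ℓ x + c * n := by
  classical
  induction n generalizing x with
  | zero =>
    have hbot : x ≠ ⊥ := by
      rintro rfl
      simp at hx
    exact ⟨.indiscrete hbot, by simp⟩
  | succ n ih =>
    obtain ⟨a, hax, ha, hbot, hla, hlb⟩ := h.exists_split_infinite_Iic hx
    obtain ⟨P, hcard, hP⟩ := ih ha
    refine ⟨P.extend hbot disjoint_sdiff_self_right (sup_sdiff_cancel_right hax),
      by rw [Finpartition.card_extend, hcard], ?_⟩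
    simp only [Finpartition.extend_parts, Finset.forall_mem_insert]
    exact ⟨by nlinarith, fun b hb => by linarith [hP b hb]⟩

theorem finset_sup_le (h : IsTameLength ℓ K c) {m r : ℕ} {s : Finset B} (hs : s.card ≤ 2 ^ r)
    (hm : ∀ b ∈ s, ℓ b ≤ m) : ℓ (s.sup id) ≤ m + c * (r + 1) := by
  classical
  induction r generalizing s with
  | zero =>
    rcases Finset.card_le_one_iff_subset_singleton.1 hs with ⟨b, hb⟩
    rcases Finset.subset_singleton_iff.1 hb with rfl | rfl
    · simpa using h.bot_le.trans (Nat.le_add_left c m)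
    · simpa using (hm b (by simp)).trans (Nat.le_add_right m c)
  | succ r ih =>
    obtain ⟨t, hts, ht⟩ := Finset.exists_subset_card_eq (Nat.div_le_self s.card 2)
    have hdiff : (s \ t).card = s.card - s.card / 2 := by rw [Finset.card_sdiff_of_subset hts, ht]
    rw [pow_succ] at hs
    have hlt := ih (s := t) (by lia) fun b hb => hm b (hts hb)
    have hlst := ih (s := s \ t) (by lia) fun b hb => hm b (Finset.sdiff_subset hb)
    rw [← Finset.union_sdiff_of_subset hts, Finset.sup_union]
    calc ℓ (t.sup id ⊔ (s \ t).sup id) ≤ max (ℓ (t.sup id)) (ℓ ((s \ t).sup id)) + c :=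
          h.sup_le _ _
      _ ≤ m + c * (r + 1) + c := by gcongr; exact max_le hlt hlst
      _ = m + c * (r + 1 + 1) := by ring

theorem two_pow_card_parts_le (h : IsTameLength ℓ K c) {x : B} (P : Finpartition x) {m r : ℕ}
    (hcard : P.parts.card ≤ 2 ^ r) (hm : ∀ b ∈ P.parts, ℓ b ≤ m) :
    2 ^ P.parts.card ≤ K ^ (m + c * (r + 1)) := by
  have hmaps : Set.MapsTo (fun s => s.sup id) (P.parts.powerset : Set (Finset B))
      {b | ℓ b ≤ m + c * (r + 1)} := by
    intro s hs
    rw [Finset.mem_coe, Finset.mem_powerset] at hs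
    exact h.finset_sup_le ((Finset.card_le_card hs).trans hcard) fun b hb => hm b (hs hb)
  have hle := (Set.encard_le_encard_of_injOn hmaps (injOn_sup_powerset_parts P)).trans
    (h.encard_le _)
  rw [Set.encard_coe_eq_coe_finsetCard, Finset.card_powerset] at hle
  exact_mod_cast hle

/- Refining each of `N` infinite parts into `2 ^ r + 1` pieces costs about `c * 2 ^ r` in length,
and the joins of the pieces cost only about `c * r` more. So there are `2 ^ (N * 2 ^ r)` elements of
length about `c * 2 ^ r`, which bounds `N`. -/
theorem exists_card_parts_le (h : IsTameLength ℓ K c) : ∃ N, ∀ (x : B) (P : Finpartition x),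
    (∀ b ∈ P.parts, (Set.Iic b).Infinite) → P.parts.card ≤ N := by
  classical
  refine ⟨K * c, fun x P hP => ?_⟩
  by_contra! hN
  set N := P.parts.card
  set m := P.parts.sup ℓ
  obtain ⟨r, hr⟩ := exists_add_mul_lt_two_pow (K * m + K * c * (N + 2)) (K * c)
  choose Q hQcard hQ using fun b hb => h.exists_finpartition (2 ^ r) (hP b hb)
  have hcard : (P.bind Q).parts.card = N * (2 ^ r + 1) := by
    rw [Finpartition.card_bind, Finset.sum_congr rfl fun b _ => hQcard b.1 b.2]
    simp [N]
  have hcard_le : (P.bind Q).parts.card ≤ 2 ^ (N + r + 1) := by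
    rw [hcard, add_assoc, pow_add]
    gcongr
    · exact Nat.lt_two_pow_self.le
    · rw [pow_succ]
      linarith [Nat.one_le_two_pow (n := r)]
  have hlen : ∀ b ∈ (P.bind Q).parts, ℓ b ≤ m + c * 2 ^ r := by
    intro b hb
    obtain ⟨a, ha, hba⟩ := Finpartition.mem_bind.1 hb
    exact (hQ a ha b hba).trans (by gcongr; exact Finset.le_sup ha)
  have hpow : 2 ^ (N * (2 ^ r + 1)) ≤ 2 ^ (K * (m + c * 2 ^ r + c * (N + r + 1 + 1))) :=
    calc 2 ^ (N * (2 ^ r + 1)) ≤ K ^ (m + c * 2 ^ r + c * (N + r + 1 + 1)) :=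
          hcard ▸ h.two_pow_card_parts_le _ hcard_le hlen
      _ ≤ (2 ^ K) ^ (m + c * 2 ^ r + c * (N + r + 1 + 1)) := by
          gcongr
          exact Nat.lt_two_pow_self.le
      _ = 2 ^ (K * (m + c * 2 ^ r + c * (N + r + 1 + 1))) := (pow_mul ..).symm
  have hexp := (Nat.pow_le_pow_iff_right Nat.one_lt_two).1 hpow
  have hlow := Nat.mul_le_mul_right (2 ^ r + 1) hN
  linarith [Nat.zero_le (K * c)]

end IsTameLength

/-! ### Indecomposable elements -/

/-- An element `x` of a Boolean algebra is indecomposable if there are infinitely many elements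
below it, but no element splits it into two parts with this property: modulo the ideal of the
elements `b` with `Set.Iic b` finite, `x` is an atom. -/
structure IsIndecomposable {B : Type*} [BooleanAlgebra B] (x : B) : Prop where
  infinite_Iic : (Set.Iic x).Infinite
  finite_or (a : B) : (Set.Iic (x ⊓ a)).Finite ∨ (Set.Iic (x \ a)).Finite

theorem finite_Iic_finset_sup {α : Type*} [DistribLattice α] [OrderBot α] {s : Finset α}
    (h : ∀ b ∈ s, (Set.Iic b).Finite) : (Set.Iic (s.sup id)).Finite :=
  Finset.sup_induction (p := fun b => (Set.Iic b).Finite) (by simp)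
    (fun _ ha _ hb => finite_Iic_sup ha hb) h

theorem exists_isAtom_le_of_finite_Iic {α : Type*} [PartialOrder α] [OrderBot α] {a : α}
    (hfin : (Set.Iic a).Finite) (ha : a ≠ ⊥) : ∃ b, IsAtom b ∧ b ≤ a := by
  have := hfin.to_subtype
  rcases eq_bot_or_exists_atom_le (⊤ : Set.Iic a) with h | ⟨b, hb, -⟩
  · exact (ha (congrArg Subtype.val h)).elim
  · exact ⟨b, hb.of_isAtom_coe_Iic, b.2⟩

theorem atom_le_finset_sup_iff {α : Type*} [DistribLattice α] [OrderBot α] {ι : Type*}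
    {a : ι → α} (hatom : ∀ i, IsAtom (a i)) (hinj : Function.Injective a) {s : Finset ι} {i : ι} :
    a i ≤ s.sup a ↔ i ∈ s := by
  refine ⟨fun h => ?_, fun h => Finset.le_sup h⟩
  by_contra hi
  refine (hatom i).not_disjoint_iff_le.2 h (Finset.disjoint_sup_right.2 fun j hj => ?_)
  exact (hatom i).disjoint_of_ne (hatom j) fun hij => hi (hinj hij ▸ hj)

namespace IsIndecomposable

variable {B : Type*} [BooleanAlgebra B] {x : B}

theorem exists_isAtom_le (hx : IsIndecomposable x) {c : B} (hcx : c ≤ x) (hc : c ≠ ⊥) :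
    ∃ b, IsAtom b ∧ b ≤ c := by
  by_contra! hatom
  have hinf {d : B} (hd : d ≠ ⊥) (hdc : d ≤ c) : (Set.Iic d).Infinite := by
    intro hfin
    obtain ⟨b, hb, hbd⟩ := exists_isAtom_le_of_finite_Iic hfin hd
    exact hatom b hb (hbd.trans hdc)
  obtain ⟨d, hdc, hd⟩ : ∃ d < c, d ≠ ⊥ := by
    by_contra! h
    exact hatom c ⟨hc, h⟩ le_rfl
  have hcd : c \ d ≠ ⊥ := fun h => hdc.not_ge (sdiff_eq_bot_iff.1 h)
  rcases hx.finite_or d with h | h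
  · exact hinf hd hdc.le (h.subset (Set.Iic_subset_Iic.2 (le_inf (hdc.le.trans hcx) le_rfl)))
  · exact hinf hcd sdiff_le (h.subset (Set.Iic_subset_Iic.2 (sdiff_le_sdiff_right hcx)))

theorem infinite_atoms (hx : IsIndecomposable x) : {b | IsAtom b ∧ b ≤ x}.Infinite := by
  intro hfin
  set a := hfin.toFinset.sup id
  have ha : (Set.Iic a).Finite := finite_Iic_finset_sup fun b hb => by
    simp [(hfin.mem_toFinset.1 hb).1.Iic_eq]
  have hxa : x \ a ≠ ⊥ := fun h =>
    hx.infinite_Iic (ha.subset (Set.Iic_subset_Iic.2 (sdiff_eq_bot_iff.1 h)))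
  obtain ⟨b, hb, hbxa⟩ := hx.exists_isAtom_le sdiff_le hxa
  have hba : b ≤ a := Finset.le_sup (f := id) (hfin.mem_toFinset.2 ⟨hb, hbxa.trans sdiff_le⟩)
  exact hb.1 (disjoint_self.1 (disjoint_sdiff_self_left.mono hbxa hba))

theorem le_iff_forall_atom_le (hx : IsIndecomposable x) {b c : B} (hbx : b ≤ x) :
    b ≤ c ↔ ∀ a, IsAtom a → a ≤ b → a ≤ c := by
  refine ⟨fun h a _ hab => hab.trans h, fun h => ?_⟩
  by_contra hbc
  obtain ⟨a, ha, hab⟩ :=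
    hx.exists_isAtom_le (sdiff_le.trans hbx) fun h => hbc (sdiff_eq_bot_iff.1 h)
  exact ha.1 (disjoint_self.1
    (disjoint_sdiff_self_left.mono hab (h a ha (hab.trans sdiff_le))))

theorem setOf_atom_le_mem_finiteCofinite (hx : IsIndecomposable x) {a : ℕ → B}
    (hatom : ∀ m, IsAtom (a m)) (hinj : Function.Injective a) (hle : ∀ m, a m ≤ x) (b : B) :
    {m | a m ≤ b} ∈ finiteCofinite := by
  rcases hx.finite_or b with h | h
  · exact .inl ((h.preimage hinj.injOn).subset fun m hm => le_inf (hle m) hm)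
  · refine .inr ((h.preimage hinj.injOn).subset fun m hm => ?_)
    exact le_sdiff.2 ⟨hle m, (hatom m).not_le_iff_disjoint.1 hm⟩

end IsIndecomposable

theorem exists_le_forall_atom_le_iff_mem {α : Type*} [GeneralizedBooleanAlgebra α] {x : α}
    {a : ℕ → α} (hatom : ∀ m, IsAtom (a m)) (hinj : Function.Injective a) (hle : ∀ m, a m ≤ x)
    {s : Set ℕ} (hs : s ∈ finiteCofinite) : ∃ b ≤ x, ∀ m, a m ≤ b ↔ m ∈ s := by
  rcases hs with hs | hs
  · exact ⟨hs.toFinset.sup a, Finset.sup_le fun m _ => hle m, fun m => by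
      rw [atom_le_finset_sup_iff hatom hinj, hs.mem_toFinset]⟩
  · refine ⟨x \ hs.toFinset.sup a, sdiff_le, fun m => ?_⟩
    rw [le_sdiff, and_iff_right (hle m), ← (hatom m).not_le_iff_disjoint,
      atom_le_finset_sup_iff hatom hinj, hs.mem_toFinset, Set.mem_compl_iff, not_not]

theorem IsIndecomposable.nonempty_orderIso {B : Type*} [BooleanAlgebra B] [Countable B] {x : B}
    (hx : IsIndecomposable x) : Nonempty (Set.Iic x ≃o finiteCofinite) := by
  have := hx.infinite_atoms.to_subtype
  obtain ⟨atoms⟩ : Nonempty (ℕ ≃ {b | IsAtom b ∧ b ≤ x}) := nonempty_equiv_of_countable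
  let a (m : ℕ) : B := atoms m
  have hatom (m : ℕ) : IsAtom (a m) := (atoms m).2.1
  have hle (m : ℕ) : a m ≤ x := (atoms m).2.2
  have hinj : Function.Injective a := Subtype.val_injective.comp atoms.injective
  let atomsBelow (b : Set.Iic x) : finiteCofinite :=
    ⟨{m | a m ≤ b}, hx.setOf_atom_le_mem_finiteCofinite hatom hinj hle b⟩
  have map_le_iff (b c : Set.Iic x) : atomsBelow b ≤ atomsBelow c ↔ b ≤ c := by
    rw [← Subtype.coe_le_coe (x := b), hx.le_iff_forall_atom_le b.2]
    refine ⟨fun h d hd hdb => ?_, fun h m => h (a m) (hatom m)⟩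
    obtain ⟨m, hm⟩ := atoms.surjective ⟨d, hd, hdb.trans b.2⟩
    obtain rfl : a m = d := congrArg Subtype.val hm
    exact h hdb
  have surjective : Function.Surjective atomsBelow := fun s => by
    obtain ⟨b, hbx, hb⟩ := exists_le_forall_atom_le_iff_mem hatom hinj hle s.2
    exact ⟨⟨b, hbx⟩, Subtype.ext (Set.ext hb)⟩
  exact ⟨RelIso.ofSurjective (OrderEmbedding.ofMapLEIff atomsBelow map_le_iff) surjective⟩

/-- Elements below a join of two disjoint elements correspond to pairs of elements below the
two: the decomposition of a Boolean algebra along a partition. -/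
def iicSupOrderIso {α : Type*} [DistribLattice α] [OrderBot α] {a b : α} (h : Disjoint a b) :
    Set.Iic (a ⊔ b) ≃o Set.Iic a × Set.Iic b where
  toFun z := (⟨z ⊓ a, inf_le_right⟩, ⟨z ⊓ b, inf_le_right⟩)
  invFun p := ⟨p.1 ⊔ p.2, sup_le_sup p.1.2 p.2.2⟩
  left_inv z := Subtype.ext ((inf_sup_left ..).symm.trans (inf_eq_left.2 z.2))
  right_inv p := by
    obtain ⟨⟨y, hy⟩, ⟨z, hz⟩⟩ := p
    simp [inf_sup_right, inf_eq_left.2 (Set.mem_Iic.1 hy), inf_eq_left.2 (Set.mem_Iic.1 hz),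
      (h.mono_left hy).eq_bot, (h.symm.mono_left hz).eq_bot]
  map_rel_iff' {y z} := by
    refine ⟨fun hyz => ?_, fun hyz => ⟨inf_le_inf_right a hyz, inf_le_inf_right b hyz⟩⟩
    rw [← Subtype.coe_le_coe, ← inf_eq_left.2 (Set.mem_Iic.1 y.2), inf_sup_left]
    exact sup_le (le_trans hyz.1 inf_le_left) (le_trans hyz.2 inf_le_left)

/-- A product of two finite powers of `γ` is again a finite power of `γ`. -/
def prodOrderIsoPow {α β γ : Type*} [Preorder α] [Preorder β] [Preorder γ] {m n : ℕ}
    (e : α ≃o (Fin m → γ)) (f : β ≃o (Fin n → γ)) : α × β ≃o (Fin (m + n) → γ) where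
  toEquiv := (e.toEquiv.prodCongr f.toEquiv).trans (Fin.appendEquiv m n)
  map_rel_iff' {p q} := by
    rw [Prod.le_def, ← e.le_iff_le, ← f.le_iff_le, Pi.le_def, Pi.le_def, Pi.le_def]
    simp [Fin.appendEquiv, Fin.forall_fin_add]

theorem card_parts_le_of_disjoint {α : Type*} [DistribLattice α] [OrderBot α] {a b x : α} {N : ℕ}
    (hN : ∀ P : Finpartition x, (∀ c ∈ P.parts, (Set.Iic c).Infinite) → P.parts.card ≤ N + 1)
    (hab : Disjoint a b) (hx : a ⊔ b = x) (hb : (Set.Iic b).Infinite) (P : Finpartition a)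
    (hP : ∀ c ∈ P.parts, (Set.Iic c).Infinite) : P.parts.card ≤ N := by
  classical
  have hbot : b ≠ ⊥ := by
    rintro rfl
    simp at hb
  have hcard := hN (P.extend hbot hab hx) (by simpa using ⟨hb, hP⟩)
  rw [Finpartition.card_extend] at hcard
  exact Nat.le_of_succ_le_succ hcard

theorem exists_nonempty_orderIso_pow {B : Type*} [BooleanAlgebra B] [Countable B] {N : ℕ} {x : B}
    (hx : (Set.Iic x).Infinite) (hN : ∀ P : Finpartition x,
      (∀ b ∈ P.parts, (Set.Iic b).Infinite) → P.parts.card ≤ N) :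
    ∃ n, 1 ≤ n ∧ Nonempty (Set.Iic x ≃o (Fin n → finiteCofinite)) := by
  classical
  induction N generalizing x with
  | zero =>
    have hbot : x ≠ ⊥ := by
      rintro rfl
      simp at hx
    simpa using hN (.indiscrete hbot) (by simpa using hx)
  | succ N ih =>
    by_cases hind : IsIndecomposable x
    · obtain ⟨e⟩ := hind.nonempty_orderIso
      exact ⟨1, le_rfl, ⟨e.trans (OrderIso.funUnique (Fin 1) finiteCofinite).symm⟩⟩
    · obtain ⟨a, ha, hb⟩ : ∃ a, (Set.Iic (x ⊓ a)).Infinite ∧ (Set.Iic (x \ a)).Infinite := by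
        by_contra! hsplit
        exact hind ⟨hx, fun a => or_iff_not_imp_left.2 (hsplit a)⟩
      have hsup : x ⊓ a ⊔ x \ a = x := sup_inf_sdiff x a
      have hdisj : Disjoint (x ⊓ a) (x \ a) := disjoint_inf_sdiff
      obtain ⟨m, hm, ⟨e⟩⟩ := ih ha (card_parts_le_of_disjoint hN hdisj hsup hb)
      obtain ⟨n, -, ⟨f⟩⟩ := ih hb (card_parts_le_of_disjoint hN hdisj.symm (sup_sdiff_inf x a) ha)
      refine ⟨m + n, hm.trans (Nat.le_add_right m n), ?_⟩
      rw [← hsup]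
      exact ⟨(iicSupOrderIso hdisj).trans (prodOrderIsoPow e f)⟩

/-- An order isomorphism between Boolean algebras, as an isomorphism of first-order structures. -/
def booleanLanguageEquivOfOrderIso {B C : Type*} [BooleanAlgebra B] [BooleanAlgebra C]
    (e : B ≃o C) : booleanLanguage.Equiv B C where
  toEquiv := e.toEquiv
  map_fun' {n} f x := by
    change BooleanFunctions n at f
    cases f with
    | bot => exact e.map_bot
    | top => exact e.map_top
    | compl => exact map_compl' e (x 0)
    | sup => exact e.map_sup (x 0) (x 1)
    | inf => exact e.map_inf (x 0) (x 1)
  map_rel' := fun r => r.elim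

theorem IsWordAutomataPresentable.finite_or_nonempty_equiv {B : Type*} [BooleanAlgebra B]
    (h : IsWordAutomataPresentable booleanLanguage B) :
    Finite B ∨ ∃ n : ℕ, 1 ≤ n ∧ Nonempty (booleanLanguage.Equiv B (Fin n → finiteCofinite)) := by
  refine or_iff_not_imp_left.2 fun hB => ?_
  rw [not_finite_iff_infinite] at hB
  obtain ⟨ℓ, K, c, hℓ⟩ := h.exists_isTameLength
  have : Countable B := by
    refine Set.countable_univ_iff.1 ((Set.countable_iUnion fun n =>
      (Set.finite_of_encard_le_coe (hℓ.encard_le n)).countable).mono fun b _ => ?_)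
    exact Set.mem_iUnion.2 ⟨ℓ b, le_refl (ℓ b)⟩
  obtain ⟨N, hN⟩ := hℓ.exists_card_parts_le
  have htop : (Set.Iic (⊤ : B)).Infinite := by simpa using Set.infinite_univ
  obtain ⟨n, hn, ⟨e⟩⟩ := exists_nonempty_orderIso_pow htop (hN ⊤)
  exact ⟨n, hn, ⟨booleanLanguageEquivOfOrderIso (OrderIso.IicTop.symm.trans e)⟩⟩

/-! ### Regularity by reading letters -/

theorem isRegular_of_forall_cons_mem_iff {α σ : Type*} [Finite σ] {G : σ → _root_.Language α}
    (h : ∀ q a, ∃ (P : Prop) (q' : σ), ∀ w, a :: w ∈ G q ↔ P ∧ w ∈ G q') (q : σ) :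
    (G q).IsRegular := by
  refine _root_.Language.IsRegular.of_finite_range_leftQuotient
    (((Set.finite_range G).insert ⊥).subset ?_)
  rintro _ ⟨w, rfl⟩
  induction w generalizing q with
  | nil => exact .inr ⟨q, rfl⟩
  | cons a w ih =>
    obtain ⟨P, q', hq'⟩ := h q a
    by_cases hP : P
    · convert ih q' using 1
      ext v
      exact (hq' (w ++ v)).trans (and_iff_right hP)
    · refine .inl (Set.eq_empty_iff_forall_notMem.2 fun v hv => hP ((hq' (w ++ v)).1 hv).1)

theorem isRegular_of_finite {α : Type*} {L : _root_.Language α} (hL : Set.Finite L) :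
    L.IsRegular := by
  refine _root_.Language.IsRegular.of_finite_range_leftQuotient
    ((hL.biUnion fun w _ => w.tails.finite_toSet).powerset.subset ?_)
  rintro _ ⟨w, rfl⟩ v hv
  exact Set.mem_biUnion hv ((List.mem_tails _ _).2 (List.suffix_append w v))

/- An automaton for the convolutions has to remember which words have already ended. -/
theorem isRegularRelation_of_forall_mem_iff_tail_mem {A σ : Type*} {k : ℕ} [Finite σ]
    {F : σ → Set (Fin k → List A)}
    (h : ∀ q (u : Fin k → Option A), ∃ (P : Prop) (q' : σ), ∀ x, (fun j => (x j).head?) = u →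
      (x ∈ F q ↔ P ∧ (fun j => (x j).tail) ∈ F q')) (q : σ) : IsRegularRelation (F q) := by
  let G (p : σ × Set (Fin k)) : _root_.Language (Fin k → Option A) :=
    convolutionLanguage {x ∈ F p.1 | ∀ j ∈ p.2, x j = []}
  suffices hG : ∀ p, (G p).IsRegular by simpa [G, IsRegularRelation] using hG (q, ∅)
  refine isRegular_of_forall_cons_mem_iff fun ⟨q, s⟩ u => ?_
  obtain ⟨P, q', hq'⟩ := h q u
  refine ⟨(∃ j, u j ≠ none) ∧ (∀ j ∈ s, u j = none) ∧ P, (q', {j | u j = none}), fun w => ?_⟩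
  constructor
  · rintro ⟨x, ⟨hx, hs⟩, hw⟩
    obtain ⟨hne, rfl, rfl⟩ := convolution_eq_cons_iff.1 hw
    obtain ⟨hP, hx'⟩ := (hq' x rfl).1 hx
    simp only [ne_eq, List.head?_eq_none_iff]
    refine ⟨⟨hne, hs, hP⟩, _, ⟨hx', fun j hj => ?_⟩, rfl⟩
    rw [show x j = [] from hj, List.tail_nil]
  · rintro ⟨⟨⟨j, hj⟩, hs, hP⟩, y, ⟨hy, hyu⟩, rfl⟩
    let x (j : Fin k) : List A := (u j).toList ++ y j
    have head_x : (fun j => (x j).head?) = u := by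
      ext1 j
      cases huj : u j <;> simp [x, huj, hyu j]
    have tail_x : (fun j => (x j).tail) = y := by
      ext1 j
      cases huj : u j <;> simp [x, huj, hyu j]
    have x_eq_nil {j : Fin k} : x j = [] ↔ u j = none := by
      rw [← List.head?_eq_none_iff, ← congrFun head_x j]
    refine ⟨x, ⟨(hq' x head_x).2 ⟨hP, tail_x.symm ▸ hy⟩, fun j hj => x_eq_nil.2 (hs j hj)⟩, ?_⟩
    exact convolution_eq_cons_iff.2 ⟨⟨j, mt x_eq_nil.1 hj⟩, head_x, by rw [tail_x]⟩

/-! ### Words for eventually constant sequences -/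

section EventuallyConstantSequences

variable {A : Type*}

/-- The sequence of the letters of a word, continued by repeating its last letter, or the letter
`a` if the word is empty. -/
def repeatLast (a : A) : List A → ℕ → A
  | [], _ => a
  | b :: _, 0 => b
  | b :: w, i + 1 => repeatLast b w i

/-- Reduced words: they are the shortest words `w` with a given value of `repeatLast a w`. They do
not end with two equal letters, the letter `a` being thought of as preceding the word. To read a
word letter by letter, `p` records whether the preceding letter may not be the last one. -/
def IsEndReduced (a : A) (p : Prop) : List A → Prop
  | [] => ¬ p
  | b :: w => IsEndReduced b (b = a) w

theorem repeatLast_zero (a : A) (w : List A) : repeatLast a w 0 = w.head?.getD a := by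
  cases w <;> rfl

theorem repeatLast_succ (a : A) (w : List A) (i : ℕ) :
    repeatLast a w (i + 1) = repeatLast (w.head?.getD a) w.tail i := by
  cases w <;> rfl

theorem isEndReduced_iff_tail {a : A} {p : Prop} {w : List A} :
    IsEndReduced a p w ↔ (w.head? = none → ¬ p) ∧
      IsEndReduced (w.head?.getD a) (w.head? = some a) w.tail := by
  cases w <;> simp [IsEndReduced]

theorem IsEndReduced.exists_repeatLast_ne {a : A} {w : List A} (hw : IsEndReduced a True w) :
    ∃ i, repeatLast a w i ≠ a := by
  induction w generalizing a with
  | nil => exact (hw trivial).elim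
  | cons b w ih =>
    by_cases hba : b = a
    · subst hba
      obtain ⟨i, hi⟩ := ih (by simpa [IsEndReduced] using hw)
      exact ⟨i + 1, hi⟩
    · exact ⟨0, hba⟩

theorem IsEndReduced.repeatLast_cons_ne {a b : A} {p : Prop} {w : List A}
    (hw : IsEndReduced a p (b :: w)) : repeatLast a (b :: w) ≠ fun _ => a := by
  intro h
  obtain rfl : b = a := congrFun h 0
  obtain ⟨i, hi⟩ := exists_repeatLast_ne (a := b) (w := w) (by simpa [IsEndReduced] using hw)
  exact hi (congrFun h (i + 1))

theorem IsEndReduced.eq_of_repeatLast_eq {a : A} {p q : Prop} {v w : List A}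
    (hv : IsEndReduced a p v) (hw : IsEndReduced a q w)
    (h : repeatLast a v = repeatLast a w) : v = w := by
  induction v generalizing a p q w with
  | nil =>
    cases w with
    | nil => rfl
    | cons c w => exact (hw.repeatLast_cons_ne h.symm).elim
  | cons b v ih =>
    cases w with
    | nil => exact (hv.repeatLast_cons_ne h).elim
    | cons c w =>
      obtain rfl : b = c := congrFun h 0
      rw [ih hv hw (funext fun i => congrFun h (i + 1))]

theorem exists_isEndReduced_of_tail {s : ℕ → A} {w : List A} (hw : IsEndReduced (s 0) False w)
    (h : ∀ i, repeatLast (s 0) w i = s (i + 1)) (a : A) :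
    ∃ v, IsEndReduced a False v ∧ repeatLast a v = s := by
  by_cases hs : w = [] ∧ s 0 = a
  · obtain ⟨rfl, rfl⟩ := hs
    exact ⟨[], id, funext fun i => Nat.casesOn i rfl h⟩
  · refine ⟨s 0 :: w, ?_, funext fun i => Nat.casesOn i rfl h⟩
    cases w with
    | nil => exact fun h => hs ⟨rfl, h⟩
    | cons b w => exact hw

theorem exists_isEndReduced_repeatLast_eq {s : ℕ → A} (hs : Filter.EventuallyConst s Filter.atTop)
    (a : A) : ∃ w, IsEndReduced a False w ∧ repeatLast a w = s := by
  obtain ⟨n, hn⟩ := Filter.eventuallyConst_atTop.1 hs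
  induction n generalizing a s with
  | zero =>
    have hconst (i : ℕ) : s 0 = s (i + 1) := (hn (i + 1) (Nat.zero_le _)).symm
    exact exists_isEndReduced_of_tail (w := []) id hconst a
  | succ n ih =>
    obtain ⟨w, hw, h⟩ := ih (hs.comp_tendsto (Filter.tendsto_add_atTop_nat 1)) (s 0)
      fun i hi => hn (i + 1) (by lia)
    exact exists_isEndReduced_of_tail hw (congrFun h) a

theorem eventuallyConst_repeatLast (a : A) (w : List A) :
    Filter.EventuallyConst (repeatLast a w) Filter.atTop := by
  induction w generalizing a with
  | nil => exact .const a
  | cons b w ih =>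
    obtain ⟨n, hn⟩ := Filter.eventuallyConst_atTop.1 (ih b)
    refine Filter.eventuallyConst_atTop.2 ⟨n + 1, fun i hi => ?_⟩
    obtain ⟨i, rfl⟩ := Nat.exists_eq_add_of_le' (Nat.one_le_of_lt hi)
    exact hn i (Nat.le_of_succ_le_succ hi)

theorem bijective_repeatLast (a : A) : Function.Bijective
    fun w : {w // IsEndReduced a False w} =>
      (⟨repeatLast a w, eventuallyConst_repeatLast a w⟩ :
        {s : ℕ → A // Filter.EventuallyConst s Filter.atTop}) := by
  constructor
  · intro v w h
    exact Subtype.ext (v.2.eq_of_repeatLast_eq w.2 (congrArg Subtype.val h))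
  · rintro ⟨s, hs⟩
    obtain ⟨w, hw, rfl⟩ := exists_isEndReduced_repeatLast_eq hs a
    exact ⟨⟨w, hw⟩, rfl⟩

variable [Finite A]

theorem isRegular_setOf_isEndReduced (a : A) :
    _root_.Language.IsRegular (T := A) {w | IsEndReduced a False w} :=
  isRegular_of_forall_cons_mem_iff (G := fun q : A × Prop => {w | IsEndReduced q.1 q.2 w})
    (fun q b => ⟨True, (b, b = q.1), fun _ => (iff_of_eq (true_and _)).symm⟩) (a, False)

theorem isRegularRelation_setOf_forall_repeatLast {k : ℕ} (ρ : (Fin k → A) → Prop) (a : A) :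
    IsRegularRelation {x : Fin k → List A |
      (∀ j, IsEndReduced a False (x j)) ∧ ∀ i, ρ fun j => repeatLast a (x j) i} := by
  refine isRegularRelation_of_forall_mem_iff_tail_mem
    (F := fun q : Fin k → A × Prop => {x | (∀ j, IsEndReduced (q j).1 (q j).2 (x j)) ∧
      ∀ i, ρ fun j => repeatLast (q j).1 (x j) i}) (fun q u => ?_) (fun _ => (a, False))
  refine ⟨(∀ j, u j = none → ¬ (q j).2) ∧ ρ fun j => (u j).getD (q j).1,
    fun j => ((u j).getD (q j).1, u j = some (q j).1), ?_⟩
  rintro x rfl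
  have forall_isEndReduced_iff : (∀ j, IsEndReduced (q j).1 (q j).2 (x j)) ↔
      (∀ j, (x j).head? = none → ¬ (q j).2) ∧
        ∀ j, IsEndReduced ((x j).head?.getD (q j).1) ((x j).head? = some (q j).1) (x j).tail := by
    rw [← forall_and]
    exact forall_congr' fun j => isEndReduced_iff_tail
  have forall_repeatLast_iff : (∀ i, ρ fun j => repeatLast (q j).1 (x j) i) ↔
      (ρ fun j => (x j).head?.getD (q j).1) ∧
        ∀ i, ρ fun j => repeatLast ((x j).head?.getD (q j).1) (x j).tail i := by
    simp only [← Nat.and_forall_add_one (p := fun i => ρ fun j => repeatLast _ (x j) i),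
      repeatLast_zero, repeatLast_succ]
  exact (and_congr forall_isEndReduced_iff forall_repeatLast_iff).trans and_and_and_comm

end EventuallyConstantSequences

/-! ### Word automatic presentations -/

theorem wordGraph_eq_wordRelation {A : Type*} {D : Set (List A)} {k : ℕ} (f : (Fin k → D) → D) :
    wordGraph f = wordRelation fun b : Fin (k + 1) → D => b (.last k) = f (Fin.init b) := by
  ext x
  constructor
  · rintro ⟨b, rfl⟩
    refine ⟨Fin.snoc b (f b), by simp, funext fun j => ?_⟩
    cases j using Fin.lastCases <;> simp
  · rintro ⟨b, hb, rfl⟩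
    refine ⟨Fin.init b, funext fun j => ?_⟩
    cases j using Fin.lastCases <;> simp [hb, Fin.init]

open FirstOrder.Language.Structure

theorem IsWordAutomataPresentable.of_equiv {L : FirstOrder.Language} {M N : Type*} [L.Structure M]
    [L.Structure N] (e : L.Equiv M N) (h : IsWordAutomataPresentable L N) :
    IsWordAutomataPresentable L M := by
  obtain ⟨A, hA, D, hD, h, ⟨e'⟩⟩ := h
  exact ⟨A, hA, D, hD, h, ⟨e'.comp e⟩⟩

theorem IsWordAutomataPresentable.of_finite (L : FirstOrder.Language) (M : Type*) [L.Structure M]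
    [Finite M] : IsWordAutomataPresentable L M := by
  let word (m : M) : List (Fin (Nat.card M)) := [Finite.equivFin M m]
  have word_injective : Function.Injective word := fun a b h => by simpa [word] using h
  let e : M ≃ Set.range word := Equiv.ofInjective word word_injective
  let := e.inducedStructure (L := L)
  have regular {k : ℕ} (r : (Fin k → Set.range word) → Prop) :
      IsRegularRelation (wordRelation r) := by
    refine isRegular_of_finite (Set.Finite.image _ ((Set.finite_range
      fun (b : Fin k → Set.range word) i => (b i).1).subset ?_))
    rintro _ ⟨b, -, rfl⟩
    exact ⟨b, rfl⟩
  refine ⟨_, inferInstance, Set.range word, _, ⟨isRegular_of_finite (Set.finite_range word),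
    fun k f => ?_, fun k r => regular _⟩, ⟨e.inducedStructureEquiv⟩⟩
  rw [wordGraph_eq_wordRelation]
  exact regular _

theorem isRegularRelation_wordRelation_of_repeatLast {A : Type*} [Finite A] {a : A} {k : ℕ}
    {r : (Fin k → {w | IsEndReduced a False w}) → Prop} {ρ : (Fin k → A) → Prop}
    (h : ∀ b, r b ↔ ∀ i, ρ fun j => repeatLast a (b j) i) :
    IsRegularRelation (wordRelation r) := by
  convert isRegularRelation_setOf_forall_repeatLast ρ a using 1
  ext x
  constructor
  · rintro ⟨b, hb, rfl⟩
    exact ⟨fun j => (b j).2, (h b).1 hb⟩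
  · rintro ⟨hx, hρ⟩
    exact ⟨fun j => ⟨x j, hx j⟩, (h _).2 hρ, rfl⟩

theorem isWordAutomataPresentable_of_equiv_eventuallyConst {L : FirstOrder.Language} {M : Type*}
    [L.Structure M] {A : Type} [Finite A] [Inhabited A]
    (e : M ≃ {s : ℕ → A // Filter.EventuallyConst s Filter.atTop})
    (hfun : ∀ {k : ℕ} (f : L.Functions k), ∃ g : (Fin k → A) → A,
      ∀ (x : Fin k → M) (i : ℕ), (e (funMap f x)).1 i = g fun j => (e (x j)).1 i)
    (hrel : ∀ {k : ℕ} (r : L.Relations k), ∃ ρ : (Fin k → A) → Prop,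
      ∀ x : Fin k → M, RelMap r x ↔ ∀ i : ℕ, ρ fun j => (e (x j)).1 i) :
    IsWordAutomataPresentable L M := by
  let words : {w | IsEndReduced (default : A) False w} ≃
      {s : ℕ → A // Filter.EventuallyConst s Filter.atTop} :=
    Equiv.ofBijective _ (bijective_repeatLast default)
  let := (e.trans words.symm).inducedStructure (L := L)
  let E := (e.trans words.symm).inducedStructureEquiv (L := L)
  have apply_symm (w : {w | IsEndReduced (default : A) False w}) :
      (e (E.symm w)).1 = repeatLast default w.1 :=
    congrArg Subtype.val (e.apply_symm_apply (words w))
  refine ⟨A, ‹_›, _, _, ⟨isRegular_setOf_isEndReduced default, fun k f => ?_, fun k r => ?_⟩, ⟨E⟩⟩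
  · obtain ⟨g, hg⟩ := hfun f
    rw [wordGraph_eq_wordRelation]
    refine isRegularRelation_wordRelation_of_repeatLast
      (ρ := fun u => u (.last k) = g (Fin.init u)) fun b => ?_
    rw [← E.symm.injective.eq_iff, E.symm.map_fun, ← e.injective.eq_iff, Subtype.ext_iff,
      funext_iff]
    simp only [hg, Function.comp_apply, apply_symm]
    rfl
  · obtain ⟨ρ, hρ⟩ := hrel r
    refine isRegularRelation_wordRelation_of_repeatLast (ρ := ρ) fun b => ?_
    rw [← E.symm.map_rel, hρ]
    simp only [Function.comp_apply, apply_symm]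

theorem mem_finiteCofinite_iff_eventuallyConst {s : Set ℕ} :
    s ∈ finiteCofinite ↔ Filter.EventuallyConst (· ∈ s) Filter.atTop := by
  rw [← Nat.cofinite_eq_atTop, Filter.eventuallyConst_pred, or_comm]
  simp only [Filter.eventually_cofinite, not_not]
  exact Iff.rfl

theorem eventuallyConst_pi_iff {ι α : Type*} {β : ι → Type*} [Finite ι] {l : Filter α}
    {f : α → ∀ i, β i} :
    Filter.EventuallyConst f l ↔ ∀ i, Filter.EventuallyConst (fun x => f x i) l := by
  refine ⟨fun h i => h.comp fun y => y i, fun h => ?_⟩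
  choose t ht hsub using h
  exact ⟨{y | ∀ i, y i ∈ t i}, Filter.eventually_all.2 ht,
    fun y hy z hz => funext fun i => hsub i (hy i) (hz i)⟩

/-- A tuple of sets of natural numbers as a sequence of sets of indices. -/
def finiteCofinitePowEquiv (n : ℕ) : (Fin n → finiteCofinite) ≃
    {s : ℕ → Fin n → Prop // Filter.EventuallyConst s Filter.atTop} where
  toFun b := ⟨fun i j => i ∈ (b j : Set ℕ), eventuallyConst_pi_iff.2 fun j =>
    mem_finiteCofinite_iff_eventuallyConst.1 (b j).2⟩
  invFun s j := ⟨{i | s.1 i j}, mem_finiteCofinite_iff_eventuallyConst.2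
    (eventuallyConst_pi_iff.1 s.2 j)⟩
  left_inv _ := rfl
  right_inv _ := rfl

theorem isWordAutomataPresentable_finiteCofinite_pow (n : ℕ) :
    IsWordAutomataPresentable booleanLanguage (Fin n → finiteCofinite) := by
  refine isWordAutomataPresentable_of_equiv_eventuallyConst (finiteCofinitePowEquiv n)
    (fun {k} f => ⟨FirstOrder.Language.Structure.funMap f, fun x i => ?_⟩) fun r => r.elim
  change BooleanFunctions k at f
  cases f <;> rfl

theorem mainTheorem2 (B : Type*) [BooleanAlgebra B] :
    IsWordAutomataPresentable booleanLanguage B ↔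
      Finite B ∨ ∃ n : ℕ, 1 ≤ n ∧ Nonempty (booleanLanguage.Equiv B (Fin n → finiteCofinite)) := by
  refine ⟨fun h => h.finite_or_nonempty_equiv, ?_⟩
  rintro (hB | ⟨n, -, ⟨e⟩⟩)
  · exact .of_finite booleanLanguage B
  · exact .of_equiv e (isWordAutomataPresentable_finiteCofinite_pow n)
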